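/- All compact spaces are assumed Hausdorff. A compact space is *Corson* if, for some cardinal $\kappa$, it is homeomorphic to a subspace of the $\Sigma$-product $\Sigma(\mathbb{R}^\kappa)=\{x\in\mathbb{R}^\kappa : \{\gamma : x(\gamma)\neq 0\}\text{ is countable}\}$ (with the topology inherited from the product topology). For a class $\mathcal{C}$ of compact spaces let $\mathcal{C}^\perp$ be the class of those compact spaces $K$ such that every continuous image of $K$ that belongs to $\mathcal{C}$ is metrizable. A compact space $K$ has *caliber $\omega_1$* if for every uncountable family $\mathcal{G}$ of nonempty open subsets of $K$ there is a point $x\in K$ such that $\{G\in\mathcal{G} : x\in G\}$ is uncountable; $K$ is *ccc* if every family of pairwise disjoint nonempty open subsets of $K$ is countable. $\mathrm{MA}_{\omega_1}$ is the statement that for every nonempty partially ordered set $P$ in which every set of pairwise incompatible elements is countable, and every family $\mathcal{D}$ of at most $\aleph_1$ dense subsets of $P$, there is a filter in $P$ that meets every member of $\mathcal{D}$. **Proposition.** Let $\mathrm{Corson}$ be the class of Corson compact spaces. Then $\mathrm{Corson}^\perp$ is exactly the class of compact spaces having caliber $\omega_1$. Moreover, $\mathrm{Corson}^\perp$ equals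 the class of all ccc compact spaces if and only if $\mathrm{MA}_{\omega_1}$ holds. -/

import Mathlib

universe u

namespace CompactClasses

/-- The `Σ`-product `Σ(ℝ^Γ)`: the points of `ℝ^Γ` with countable support. Used as a type it carries
the subspace topology of the product topology. -/
def sigmaProduct (Γ : Type u) : Set (Γ → ℝ) :=
  {x | (Function.support x).Countable}

/-- The class of Corson compacta: compact Hausdorff spaces homeomorphic to a subspace of some
`Σ`-product `Σ(ℝ^Γ)`. -/
def corson : Set CompHaus.{u} :=
  {K | ∃ (Γ : Type u) (e : K → sigmaProduct Γ), Topology.IsEmbedding e}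

/-- The orthogonal `𝒞^⊥` of a class `𝒞` of compact spaces: all compact Hausdorff spaces `K` such that
every continuous image of `K` that belongs to `𝒞` is metrizable. -/
def orthogonal (𝒞 : Set CompHaus.{u}) : Set CompHaus.{u} :=
  {K | ∀ L ∈ 𝒞, (∃ f : K → L, Continuous f ∧ Function.Surjective f) →
    TopologicalSpace.MetrizableSpace L}

/-- The class of compact spaces having caliber `ω₁`: for every uncountable family `𝒢` of nonempty
open sets some point belongs to uncountably many members of `𝒢`. -/
def caliberOmegaOne : Set CompHaus.{u} :=
  {K | ∀ 𝒢 : Set (Set K), ¬ 𝒢.Countable → (∀ G ∈ 𝒢, IsOpen G ∧ G.Nonempty) →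
    ∃ x : K, ¬ {G ∈ 𝒢 | x ∈ G}.Countable}

/-- The class of compact spaces satisfying the countable chain condition: every family of pairwise
disjoint nonempty open sets is countable. -/
def ccc : Set CompHaus.{u} :=
  {K | ∀ 𝒢 : Set (Set K), (∀ G ∈ 𝒢, IsOpen G ∧ G.Nonempty) →
    𝒢.Pairwise Disjoint → 𝒢.Countable}

/-- Two elements of a partially ordered set are compatible if they have a common lower bound. -/
def Compatible {P : Type u} [PartialOrder P] (p q : P) : Prop :=
  ∃ r, r ≤ p ∧ r ≤ q

/-- A partially ordered set is ccc if every set of pairwise incompatible elements is countable. -/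
def IsCCCPoset (P : Type u) [PartialOrder P] : Prop :=
  ∀ A : Set P, A.Pairwise (fun p q => ¬ Compatible p q) → A.Countable

/-- A subset of a partially ordered set is (downward) dense if every element of the partially
ordered set has an element of the subset below it. -/
def IsDenseSubset {P : Type u} [PartialOrder P] (D : Set P) : Prop :=
  ∀ p, ∃ d ∈ D, d ≤ p

/-- Martin's axiom `MA_{ω₁}`: for every nonempty ccc partially ordered set and every family of at
most `ℵ₁` dense subsets there is a filter meeting all of them. (An `Order.PFilter` is nonempty,
upward closed and downward directed.) -/
def MartinAxiomOmegaOne : Prop :=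
  ∀ (P : Type u) [PartialOrder P] [Nonempty P], IsCCCPoset P →
    ∀ 𝒟 : Set (Set P), Cardinal.mk 𝒟 ≤ Cardinal.aleph 1 → (∀ D ∈ 𝒟, IsDenseSubset D) →
      ∃ F : Order.PFilter P, ∀ D ∈ 𝒟, ((F : Set P) ∩ D).Nonempty

end CompactClasses

/-!
The space `K` has caliber `ω₁` if and only if its Corson images are metrizable, because a compact
subset of a `Σ`-product is metrizable exactly when only countably many coordinates are not
identically zero on it, and families of open sets of `K` translate into families of coordinates by
Urysohn functions. Since caliber `ω₁` implies ccc, what remains is that all ccc compact spaces have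
caliber `ω₁` if and only if `MA_{ω₁}` holds.

If `MA_{ω₁}` holds, then a sufficiently generic filter of open sets of a ccc compact space has a
limit point in uncountably many members of a given uncountable family
(`ccc_subset_caliberOmegaOne`).

Conversely, suppose that all ccc compact spaces have caliber `ω₁`. Passing from a partially ordered
set to a compact space of maximal centered subsets, one finds that every ccc partially ordered set
has precaliber `ω₁` (`CCCPrecaliber`). This property implies Martin's axiom. The work is done by
`CCCPrecaliber.exists_centered_classes`: if `ω₁` many sequences are such that any finitely many of
them split into `v n` classes with lower bounds at almost all places `n`, then uncountably many of
them split into `2 * v n` centered classes at all places. The witnessing partially ordered set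
consists of finite sets of indices ordered by reverse inclusion. Applied to sequences which code the
initial segments of `ω₁`, this yields for families of size `ℵ₁`
* domination of functions on `ℕ` (`CCCPrecaliber.exists_eventually_le_atTop`),
* the decomposition of a ccc partially ordered set into countably many centered sets
  (`CCCPrecaliber.exists_centered_coloring`),
* sequences eventually contained in all members of a family of subsets of `ℕ` with the finite
  intersection property (`CCCPrecaliber.exists_eventually_mem`).

A filter meeting `ℵ₁` dense subsets of a ccc partially ordered set of size `ℵ₁` is then built along
a branch of a tree of finite sequences of natural numbers
(`CCCPrecaliber.exists_pfilter_of_isLowerSet`): a decomposition into centered sets replaces elements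
by natural numbers, pseudo-intersections provide successor nodes that serve all dense sets at once,
and domination provides the branch. The restriction on the size is removed by taking a subset closed
under suitable operations.
-/

universe v

namespace CompactClasses

open Set Filter Topology Cardinal

/-! ### Corson images and caliber `ω₁` -/

theorem exists_not_countable_fiber {I J : Type*} [Countable J] {s : Set I} (hs : ¬ s.Countable)
    (f : I → J) : ∃ j, ¬ {i ∈ s | f i = j}.Countable := by
  by_contra! h
  refine hs ((countable_iUnion h).mono fun i hi => ?_)
  exact mem_iUnion.2 ⟨f i, hi, rfl⟩

/-- Caliber `ω₁` for indexed families of open sets, in which a set may be repeated. -/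
theorem exists_not_countable_setOf_mem {K : CompHaus.{u}} (hK : K ∈ caliberOmegaOne) {I : Type*}
    {s : Set I} (hs : ¬ s.Countable) (G : I → Set K)
    (hG : ∀ i ∈ s, IsOpen (G i) ∧ (G i).Nonempty) : ∃ x : K, ¬ {i ∈ s | x ∈ G i}.Countable := by
  by_cases hc : (G '' s).Countable
  · have : Countable (G '' s) := hc
    have hs' : ¬ (univ : Set s).Countable := fun h => hs (by
      have := h.image (Subtype.val : s → I)
      simpa using this)
    obtain ⟨⟨U, hU⟩, hj⟩ :=
      exists_not_countable_fiber hs' (fun i : s => (⟨G i, mem_image_of_mem G i.2⟩ : G '' s))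
    obtain ⟨i, hi, rfl⟩ := hU
    obtain ⟨x, hx⟩ := (hG i hi).2
    refine ⟨x, fun h => hj ?_⟩
    refine (h.preimage Subtype.val_injective).mono fun k hk => ?_
    have hGk : G k = G i := congrArg Subtype.val hk.2
    exact ⟨k.2, hGk ▸ hx⟩
  · obtain ⟨x, hx⟩ := hK (G '' s) hc (by rintro _ ⟨i, hi, rfl⟩; exact hG i hi)
    refine ⟨x, fun h => hx ((h.image G).mono ?_)⟩
    rintro _ ⟨⟨i, hi, rfl⟩, hxi⟩
    exact ⟨i, ⟨hi, hxi⟩, rfl⟩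

/-- If a space of caliber `ω₁` maps onto `L ⊆ Σ(ℝ^Γ)`, then only countably many coordinates are not
identically zero on `L`: a point in uncountably many of the open sets where a coordinate does not
vanish would have uncountable support. -/
theorem caliberOmegaOne_subset_orthogonal_corson :
    caliberOmegaOne.{u} ⊆ orthogonal corson.{u} := by
  rintro K hK L ⟨Γ, e, he⟩ ⟨f, hf, hfs⟩
  set s : Set Γ := {γ | ∃ k, (e (f k) : Γ → ℝ) γ ≠ 0} with hsdef
  have hcoord : ∀ γ : Γ, Continuous fun y : L => (e y : Γ → ℝ) γ := fun γ =>
    (continuous_apply γ).comp (continuous_subtype_val.comp he.continuous)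
  have hs : s.Countable := by
    by_contra hs
    obtain ⟨x, hx⟩ := exists_not_countable_setOf_mem hK hs
      (fun γ => {k | (e (f k) : Γ → ℝ) γ ≠ 0})
      (fun γ hγ => ⟨isOpen_ne_fun ((hcoord γ).comp hf) continuous_const, hγ⟩)
    refine hx (((e (f x)).2).mono fun γ hγ => ?_)
    exact hγ.2
  have : Countable s := hs
  let g : L → s → ℝ := fun y γ => (e y : Γ → ℝ) γ
  have hg : Continuous g := continuous_pi fun γ => hcoord γ
  have hinj : Function.Injective g := by
    intro y z hyz
    apply he.injective
    apply Subtype.ext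
    funext γ
    by_cases hγ : γ ∈ s
    · exact congrFun hyz ⟨γ, hγ⟩
    · have h0 : ∀ y : L, (e y : Γ → ℝ) γ = 0 := by
        intro y
        obtain ⟨k, rfl⟩ := hfs y
        by_contra h
        exact hγ ⟨k, h⟩
      rw [h0, h0]
  have hemb : IsEmbedding g := (hg.isClosedEmbedding hinj).isEmbedding
  exact hemb.metrizableSpace

theorem exists_continuous_ne_zero {X : Type*} [TopologicalSpace X] [CompactSpace X] [T2Space X]
    {G : Set X} (hG : IsOpen G) (hne : G.Nonempty) :
    ∃ f : X → ℝ, Continuous f ∧ (∀ x, f x ≠ 0 → x ∈ G) ∧ ∃ x, f x ≠ 0 := by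
  obtain ⟨p, hp⟩ := hne
  obtain ⟨f, hf0, hf1, -⟩ := exists_continuous_zero_one_of_isClosed
    hG.isClosed_compl (isClosed_singleton (x := p)) (by simpa using hp)
  refine ⟨f, f.continuous, fun x hx => ?_, p, ?_⟩
  · by_contra h
    exact hx (hf0 h)
  · rw [hf1 rfl]; simp

/-- If every point of `K` is in only countably many members of `𝒢`, then functions supported on the
members of `𝒢` map `K` onto a Corson compact space. If this space is metrizable, then the supports
of the points of a countable dense subset cover `𝒢`. -/
theorem orthogonal_corson_subset_caliberOmegaOne :
    orthogonal corson.{u} ⊆ caliberOmegaOne.{u} := by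
  intro K hK 𝒢 h𝒢 hopen
  by_contra! hx
  have hf : ∀ G : 𝒢, ∃ f : K → ℝ, Continuous f ∧ (∀ x, f x ≠ 0 → x ∈ G.1) ∧ ∃ x, f x ≠ 0 := by
    rintro ⟨G, hG⟩
    exact exists_continuous_ne_zero (hopen G hG).1 (hopen G hG).2
  choose f hfc hfG hfne using hf
  let F : K → 𝒢 → ℝ := fun x G => f G x
  have hF : Continuous F := continuous_pi hfc
  have hsupp : ∀ x, (Function.support (F x)).Countable := fun x =>
    ((hx x).preimage (Subtype.val_injective (p := (· ∈ 𝒢)))).mono fun G hG => by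
      exact ⟨G.2, hfG G x hG⟩
  have : CompactSpace (range F) := isCompact_iff_compactSpace.1 (isCompact_range hF)
  let L : CompHaus.{u} := CompHaus.of (range F)
  have hL : L ∈ corson := by
    refine ⟨𝒢, fun y : range F => ⟨y.1, ?_⟩, ?_⟩
    · obtain ⟨_, x, rfl⟩ := y
      exact hsupp x
    · exact IsEmbedding.subtypeVal.codRestrict _ _
  have hmet : TopologicalSpace.MetrizableSpace (range F) :=
    hK L hL ⟨rangeFactorization F, hF.subtype_mk _, rangeFactorization_surjective⟩
  let _ := TopologicalSpace.metrizableSpaceMetric (range F)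
  obtain ⟨D, hDc, hDd⟩ := TopologicalSpace.exists_countable_dense (range F)
  apply h𝒢
  have hcov : (univ : Set 𝒢) ⊆ ⋃ d ∈ D, Function.support d.1 := by
    intro G _
    obtain ⟨x, hx⟩ := hfne G
    have ho : IsOpen {y : range F | y.1 G ≠ 0} :=
      isOpen_ne_fun ((continuous_apply G).comp continuous_subtype_val) continuous_const
    obtain ⟨d, hd, hdD⟩ := hDd.inter_open_nonempty _ ho ⟨⟨F x, x, rfl⟩, hx⟩
    exact mem_biUnion hdD hd
  have hc : (univ : Set 𝒢).Countable := (hDc.biUnion (by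
    rintro ⟨_, x, rfl⟩ _
    exact hsupp x)).mono hcov
  simpa using hc.image (Subtype.val : 𝒢 → Set K)

theorem caliberOmegaOne_subset_ccc : caliberOmegaOne.{u} ⊆ ccc.{u} := by
  intro K hK 𝒢 hopen hdisj
  by_contra h
  obtain ⟨x, hx⟩ := hK 𝒢 h hopen
  refine hx (Set.Subsingleton.countable ?_)
  rintro G ⟨hG, hxG⟩ H ⟨hH, hxH⟩
  by_contra hne
  exact disjoint_left.1 (hdisj hG hH hne) hxG hxH

/-! ### Martin's axiom gives caliber `ω₁` -/

/-- The first uncountable well-order, as a type in the universe `u`. -/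
abbrev OmegaOne : Type u := (aleph.{u} 1).ord.ToType

theorem mk_omegaOne : #OmegaOne.{u} = aleph 1 := by
  simp

instance uncountable_omegaOne : Uncountable OmegaOne.{u} := by
  rw [← aleph0_lt_mk_iff, mk_omegaOne, ← aleph_one_le_iff]

theorem countable_Iio_omegaOne (a : OmegaOne.{u}) : (Iio a).Countable := by
  rw [← le_aleph0_iff_set_countable, ← not_lt, ← aleph_one_le_iff, not_le]
  exact (mk_Iio_lt a (by simp)).trans_eq mk_omegaOne

theorem countable_Iic_omegaOne (a : OmegaOne.{u}) : (Iic a).Countable := by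
  rw [← Iio_insert]
  exact (countable_Iio_omegaOne a).insert a

theorem exists_gt_of_not_countable {s : Set OmegaOne.{u}} (hs : ¬ s.Countable) (a : OmegaOne.{u}) :
    ∃ b ∈ s, a < b := by
  by_contra! h
  exact hs ((countable_Iic_omegaOne a).mono h)

/-- A type with at most `ℵ₁` elements is enumerated by `ω₁`. -/
theorem exists_surjective_omegaOne {I : Type u} [Nonempty I] (hI : #I ≤ aleph 1) :
    ∃ f : OmegaOne.{u} → I, Function.Surjective f := by
  rw [← mk_omegaOne] at hI
  obtain ⟨g⟩ := hI
  exact ⟨Function.invFun g, Function.invFun_surjective g.injective⟩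

/-- In a ccc space, an uncountable family of nonempty open sets is everywhere uncountable below
some nonempty open set: otherwise the open sets meeting countably many members of the family would
have a maximal disjoint subfamily with dense union, and that subfamily is countable. -/
theorem exists_open_forall_not_countable {K : CompHaus.{u}} (hK : K ∈ ccc) {I : Type*}
    [Uncountable I] (G : I → Set K) (hG : ∀ i, IsOpen (G i) ∧ (G i).Nonempty) :
    ∃ V : Set K, IsOpen V ∧ V.Nonempty ∧ ∀ U ⊆ V, IsOpen U → U.Nonempty →
      ¬ {i | (G i ∩ U).Nonempty}.Countable := by
  by_contra! h
  let 𝔅 : Set (Set K) := {U | (IsOpen U ∧ U.Nonempty) ∧ {i | (G i ∩ U).Nonempty}.Countable}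
  obtain ⟨𝒰, h𝒰⟩ := zorn_subset {𝒰 : Set (Set K) | 𝒰 ⊆ 𝔅 ∧ 𝒰.Pairwise Disjoint} (by
    intro c hc hchain
    refine ⟨⋃₀ c, ⟨sUnion_subset fun 𝒱 h𝒱 => (hc h𝒱).1, ?_⟩, fun 𝒱 h𝒱 => subset_sUnion_of_mem h𝒱⟩
    exact (pairwise_sUnion hchain.directedOn).2 fun 𝒱 h𝒱 => (hc h𝒱).2)
  have hcount : 𝒰.Countable := hK 𝒰 (fun U hU => (h𝒰.prop.1 hU).1) h𝒰.prop.2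
  refine not_countable (α := I) (countable_univ_iff.1 ?_)
  refine (hcount.biUnion fun U hU => (h𝒰.prop.1 hU).2).mono fun i _ => ?_
  by_contra hi
  obtain ⟨U, hUG, hUo, hUne, hUc⟩ := h (G i) (hG i).1 (hG i).2
  have hdisj : ∀ V ∈ 𝒰, Disjoint U V := by
    intro V hV
    rw [disjoint_iff_inter_eq_empty, ← not_nonempty_iff_eq_empty]
    rintro ⟨x, hxU, hxV⟩
    exact hi (mem_biUnion hV ⟨x, hUG hxU, hxV⟩)
  have hmem : U ∈ 𝒰 := by
    refine h𝒰.le_of_ge (y := insert U 𝒰) ⟨insert_subset ⟨⟨hUo, hUne⟩, hUc⟩ h𝒰.prop.1, ?_⟩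
      (subset_insert _ _) (mem_insert _ _)
    refine h𝒰.prop.2.insert fun V hV _ => ⟨hdisj V hV, (hdisj V hV).symm⟩
  exact hUne.ne_empty (disjoint_self.1 (hdisj U hmem))

theorem exists_open_closure_subset {X : Type*} [TopologicalSpace X] [CompactSpace X] [T2Space X]
    {O : Set X} (hO : IsOpen O) (hne : O.Nonempty) :
    ∃ U, IsOpen U ∧ U.Nonempty ∧ closure U ⊆ O := by
  obtain ⟨x, hx⟩ := hne
  obtain ⟨U, hU, hxU, hUO⟩ := exists_open_between_and_isCompact_closure
    (isCompact_singleton (x := x)) hO (by simpa using hx)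
  exact ⟨U, hU, ⟨x, hxU rfl⟩, hUO.1⟩

/-- Under `MA_{ω₁}`, every ccc compact space has caliber `ω₁`: a filter of open sets that is generic
enough has a limit point lying in cofinally many members of a given `ω₁`-sequence of open sets. -/
theorem ccc_subset_caliberOmegaOne (hMA : MartinAxiomOmegaOne.{u}) :
    ccc.{u} ⊆ caliberOmegaOne.{u} := by
  intro K hK 𝒢 h𝒢 hopen
  have h1 : #OmegaOne.{u} ≤ #𝒢 := by
    rw [mk_omegaOne, aleph_one_le_iff, ← not_le]
    exact fun h => h𝒢 (le_aleph0_iff_set_countable.1 h)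
  obtain ⟨g⟩ := h1
  obtain ⟨V, hVo, hVne, hV⟩ := exists_open_forall_not_countable hK
    (fun i => (g i : Set K)) fun i => hopen _ (g i).2
  let P := {U : Set K // IsOpen U ∧ U.Nonempty ∧ U ⊆ V}
  have : Nonempty P := ⟨⟨V, hVo, hVne, Subset.rfl⟩⟩
  have hP : IsCCCPoset P := by
    intro A hA
    have : (Subtype.val '' A : Set (Set K)).Countable := by
      apply hK
      · rintro _ ⟨U, -, rfl⟩
        exact ⟨U.2.1, U.2.2.1⟩
      · rintro _ ⟨U, hU, rfl⟩ _ ⟨U', hU', rfl⟩ hne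
        rw [disjoint_iff_inter_eq_empty, ← not_nonempty_iff_eq_empty]
        intro hI
        exact hA hU hU' (fun h => hne (congrArg _ h))
          ⟨⟨U.1 ∩ U'.1, U.2.1.inter U'.2.1, hI, inter_subset_left.trans U.2.2.2⟩,
            fun _ h => h.1, fun _ h => h.2⟩
    exact countable_of_injective_of_countable_image Subtype.val_injective.injOn this
  let D : OmegaOne.{u} → Set P := fun a => {U | ∃ b, a < b ∧ closure U.1 ⊆ g b}
  have hD : ∀ a, IsDenseSubset (D a) := by
    rintro a ⟨U, hUo, hUne, hUV⟩
    obtain ⟨b, hb, hab⟩ := exists_gt_of_not_countable (hV U hUV hUo hUne) a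
    obtain ⟨U', hU'o, hU'ne, hU'⟩ :=
      exists_open_closure_subset ((hopen _ (g b).2).1.inter hUo) hb
    have hsub : U' ⊆ (g b : Set K) ∩ U := subset_closure.trans hU'
    exact ⟨⟨U', hU'o, hU'ne, fun x hx => hUV (hsub hx).2⟩,
      ⟨b, hab, fun x hx => (hU' hx).1⟩, fun x hx => (hsub hx).2⟩
  obtain ⟨F, hF⟩ := hMA P hP (range D)
    (mk_range_le.trans mk_omegaOne.le) (by rintro _ ⟨a, rfl⟩; exact hD a)
  have hFne : Nonempty (F : Set P) := F.nonempty.to_subtype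
  obtain ⟨x, hx⟩ := IsCompact.nonempty_iInter_of_directed_nonempty_isCompact_isClosed
    (fun U : (F : Set P) => closure U.1.1)
    (by
      rintro ⟨U, hU⟩ ⟨U', hU'⟩
      obtain ⟨U'', hU'', h1, h2⟩ := F.directed U hU U' hU'
      exact ⟨⟨U'', hU''⟩, closure_mono h1, closure_mono h2⟩)
    (fun U => U.1.2.2.1.closure) (fun U => isClosed_closure.isCompact)
    (fun U => isClosed_closure)
  refine ⟨x, fun hc => ?_⟩
  have hc' : {b : OmegaOne.{u} | x ∈ (g b : Set K)}.Countable := by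
    refine (hc.preimage (Subtype.val_injective.comp g.injective)).mono fun b hb => ?_
    exact ⟨(g b).2, hb⟩
  obtain ⟨a, ha⟩ : ∃ a, ∀ b, x ∈ (g b : Set K) → b ≤ a := by
    by_contra! h
    refine not_countable (α := OmegaOne.{u}) (countable_univ_iff.1 ?_)
    refine (hc'.biUnion fun b _ => countable_Iio_omegaOne b).mono fun a _ => ?_
    obtain ⟨b, hb, hab⟩ := h a
    exact mem_biUnion (show b ∈ {b : OmegaOne.{u} | x ∈ (g b : Set K)} from hb) hab
  obtain ⟨U, hUF, b, hab, hUb⟩ := hF (D a) ⟨a, rfl⟩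
  exact (ha b (hUb (mem_iInter.1 hx ⟨U, hUF⟩))).not_gt hab

/-! ### Partially ordered sets and compact spaces -/

/-- The family `f` is centered on `A`: any finitely many of its members with index in `A` have a
common lower bound in the partially ordered set `R`. -/
def CenteredOn {R : Type u} [PartialOrder R] {I : Type v} (f : I → R) (A : Set I) : Prop :=
  ∀ Γ : Finset I, ↑Γ ⊆ A → ∃ r, ∀ i ∈ Γ, r ≤ f i

/-- Every ccc partially ordered set has precaliber `ω₁`: uncountable families have uncountable
centered subfamilies. -/
def CCCPrecaliber : Prop :=
  ∀ (R : Type u) [PartialOrder R], IsCCCPoset R → ∀ (I : Type u) [Uncountable I] (f : I → R),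
    ∃ A : Set I, ¬ A.Countable ∧ CenteredOn f A

section Stone

variable (R : Type u) [PartialOrder R]

/-- The maximal centered subsets of a partially ordered set. -/
def maximalCentered : Set (Set R) :=
  {F | Maximal (CenteredOn (id : R → R)) F}

variable {R}

theorem exists_mem_maximalCentered (r : R) : ∃ F ∈ maximalCentered R, r ∈ F := by
  obtain ⟨F, hrF, hF⟩ := zorn_subset_nonempty {F : Set R | CenteredOn (id : R → R) F} (by
    intro c hc hchain hne
    refine ⟨⋃₀ c, fun Γ hΓ => ?_, fun s hs => subset_sUnion_of_mem hs⟩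
    obtain ⟨t, ht, hΓt⟩ := DirectedOn.exists_mem_subset_of_finset_subset_biUnion hne
      (f := id) (by simpa [Function.onFun] using hchain.directedOn) (s := Γ)
      (by simpa [sUnion_eq_biUnion] using hΓ)
    exact hc ht Γ hΓt) {r} (by
    intro Γ hΓ
    exact ⟨r, fun i hi => (by simpa using hΓ hi : i = r).ge⟩)
  exact ⟨F, hF, hrF rfl⟩

theorem mem_of_le_of_mem_maximalCentered {F : Set R} (hF : F ∈ maximalCentered R) {q r : R}
    (hq : q ∈ F) (hqr : q ≤ r) : r ∈ F := by
  classical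
  refine hF.le_of_ge (y := insert r F) (fun Γ hΓ => ?_) (subset_insert r F) (mem_insert r F)
  obtain ⟨l, hl⟩ := hF.prop (insert q (Γ.erase r)) (by
    intro i hi
    rcases Finset.mem_insert.1 hi with rfl | hi
    · exact hq
    · rw [Finset.mem_erase] at hi
      exact (hΓ hi.2).resolve_left hi.1)
  refine ⟨l, fun i hi => ?_⟩
  by_cases hir : i = r
  · subst hir
    exact (hl q (Finset.mem_insert_self _ _)).trans hqr
  · exact hl i (Finset.mem_insert_of_mem (Finset.mem_erase.2 ⟨hir, hi⟩))

theorem exists_finset_of_notMem_maximalCentered {F : Set R} (hF : F ∈ maximalCentered R) {r : R}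
    (hr : r ∉ F) : ∃ Γ : Finset R, ↑Γ ⊆ F ∧ ¬ ∃ l, l ≤ r ∧ ∀ i ∈ Γ, l ≤ i := by
  classical
  by_contra! h
  refine hr (hF.le_of_ge (y := insert r F) (fun Γ hΓ => ?_) (subset_insert r F) (mem_insert r F))
  obtain ⟨l, hlr, hl⟩ := h (Γ.erase r) (by
    intro i hi
    have := Finset.mem_erase.1 hi
    exact (hΓ this.2).resolve_left this.1)
  refine ⟨l, fun i hi => ?_⟩
  by_cases hir : i = r
  · exact hir ▸ hlr
  · exact hl i (Finset.mem_erase.2 ⟨hir, hi⟩)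

open Classical in
/-- The characteristic function of a subset of `R`, as a point of the Cantor cube over `R`. -/
noncomputable def indicatorBool (F : Set R) : R → Bool := fun r => decide (r ∈ F)

variable (R) in
/-- The compact space associated with a partially ordered set: the closure in the Cantor cube of
the set of its maximal centered subsets. -/
noncomputable def centeredSpace : CompHaus.{u} :=
  haveI : CompactSpace (closure (indicatorBool '' maximalCentered R)) :=
    isCompact_iff_compactSpace.1 isClosed_closure.isCompact
  CompHaus.of (closure (indicatorBool '' maximalCentered R))

/-- The point of `centeredSpace R` given by a maximal centered set. -/
noncomputable def centeredPoint {F : Set R} (hF : F ∈ maximalCentered R) : centeredSpace R :=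
  (⟨indicatorBool F, subset_closure (mem_image_of_mem _ hF)⟩ :
    closure (indicatorBool '' maximalCentered R))

/-- The elements of `R` give a `π`-base of the dense subspace of maximal centered sets: to contain
finitely many given elements and, by maximality, to avoid finitely many others is a condition that
a single `q : R` can enforce. -/
theorem exists_forall_centeredPoint_mem {O : Set (centeredSpace R)} (hO : IsOpen O)
    (hne : O.Nonempty) :
    ∃ q : R, ∀ F (hF : F ∈ maximalCentered R), q ∈ F → centeredPoint hF ∈ O := by
  classical
  obtain ⟨O', hO', rfl⟩ := isOpen_induced_iff.1 hO
  obtain ⟨⟨x, hx⟩, hxO⟩ := hne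
  obtain ⟨_, hyO, F, hF, rfl⟩ := mem_closure_iff.1 hx O' hO' hxO
  obtain ⟨t, U, htU, ht⟩ := isOpen_pi_iff.1 hO' _ hyO
  have hex : ∀ r, ∃ Γ : Finset R, ↑Γ ⊆ F ∧ (r ∉ F → ¬ ∃ l, l ≤ r ∧ ∀ i ∈ Γ, l ≤ i) := by
    intro r
    by_cases hr : r ∈ F
    · exact ⟨∅, by simp, fun h => absurd hr h⟩
    · obtain ⟨Γ, h1, h2⟩ := exists_finset_of_notMem_maximalCentered hF hr
      exact ⟨Γ, h1, fun _ => h2⟩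
  choose N hNF hN using hex
  obtain ⟨q, hq⟩ := hF.prop (t.filter (· ∈ F) ∪ t.biUnion N) (by
    intro i hi
    rcases Finset.mem_union.1 hi with hi | hi
    · exact (Finset.mem_filter.1 hi).2
    · obtain ⟨r, -, hir⟩ := Finset.mem_biUnion.1 hi
      exact hNF r hir)
  refine ⟨q, fun F' hF' hqF' => ht ?_⟩
  intro r hr
  have hiff : r ∈ F' ↔ r ∈ F := by
    constructor
    · intro hrF'
      by_contra hrF
      obtain ⟨l, hl⟩ := hF'.prop {q, r} (by
        intro i hi
        rcases (by simpa using hi : i = q ∨ i = r) with rfl | rfl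
        exacts [hqF', hrF'])
      refine hN r hrF ⟨l, hl r (by simp), fun i hi => (hl q (by simp)).trans (hq i ?_)⟩
      exact Finset.mem_union_right _ (Finset.mem_biUnion.2 ⟨r, hr, hi⟩)
    · intro hrF
      refine mem_of_le_of_mem_maximalCentered hF' hqF' (hq r ?_)
      exact Finset.mem_union_left _ (Finset.mem_filter.2 ⟨hr, hrF⟩)
  have := (htU r hr).2
  simpa [centeredPoint, indicatorBool, hiff] using this

theorem centeredSpace_mem_ccc (hR : IsCCCPoset R) : centeredSpace R ∈ ccc := by
  intro 𝒢 hopen hdisj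
  have hex : ∀ G : 𝒢, ∃ q : R, ∀ F (hF : F ∈ maximalCentered R), q ∈ F →
      centeredPoint hF ∈ G.1 := fun G =>
    exists_forall_centeredPoint_mem (hopen G.1 G.2).1 (hopen G.1 G.2).2
  choose q hq using hex
  have key : ∀ G H : 𝒢, Compatible (q G) (q H) → G = H := by
    rintro G H ⟨r, hrG, hrH⟩
    obtain ⟨F, hF, hrF⟩ := exists_mem_maximalCentered r
    by_contra hne
    exact disjoint_left.1 (hdisj G.2 H.2 (fun h => hne (Subtype.ext h)))
      (hq G F hF (mem_of_le_of_mem_maximalCentered hF hrF hrG))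
      (hq H F hF (mem_of_le_of_mem_maximalCentered hF hrF hrH))
  have hinj : Function.Injective q := fun G H h => key G H ⟨q G, le_rfl, h.le⟩
  have : (range q).Countable := by
    apply hR
    rintro _ ⟨G, rfl⟩ _ ⟨H, rfl⟩ hne hc
    exact hne (congrArg q (key G H hc))
  have h𝒢 : Countable 𝒢 := by
    have := this.to_subtype
    exact (rangeFactorization_injective.2 hinj).countable
  exact h𝒢

end Stone

/-- A point lying in uncountably many of the clopen sets `{F | f i ∈ F}` selects an uncountable
centered subfamily of `f`. -/
theorem cccPrecaliber_of_ccc_subset (h : ccc.{u} ⊆ caliberOmegaOne.{u}) : CCCPrecaliber.{u} := by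
  intro R _ hR I _ f
  let G : I → Set (centeredSpace R) := fun i => {x | x.1 (f i) = true}
  have hG : ∀ i, IsOpen (G i) ∧ (G i).Nonempty := by
    refine fun i => ⟨?_, ?_⟩
    · have : Continuous fun x : closure (indicatorBool '' maximalCentered R) => x.1 (f i) :=
        (continuous_apply (f i)).comp continuous_subtype_val
      exact (isOpen_discrete {true}).preimage this
    · obtain ⟨F, hF, hi⟩ := exists_mem_maximalCentered (f i)
      refine ⟨centeredPoint hF, ?_⟩
      change indicatorBool F (f i) = true
      simpa [indicatorBool] using hi
  obtain ⟨⟨x, hxc⟩, hx⟩ := exists_not_countable_setOf_mem (h (centeredSpace_mem_ccc hR))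
    (s := (univ : Set I)) (by rw [countable_univ_iff]; exact not_countable) G fun i _ => hG i
  refine ⟨_, hx, fun Γ hΓ => ?_⟩
  obtain ⟨_, hy, F, hF, rfl⟩ := mem_closure_iff.1 hxc
    (⋂ i ∈ Γ, {y : R → Bool | y (f i) = true})
    (isOpen_biInter_finset fun i _ =>
      (isOpen_discrete {true}).preimage (continuous_apply (A := fun _ => Bool) (f i)))
    (mem_iInter₂.2 fun i hi => (hΓ hi).2)
  classical
  obtain ⟨r, hr⟩ := hF.prop (Γ.image f) (by
    intro r hr
    obtain ⟨i, hi, rfl⟩ := Finset.mem_image.1 hr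
    have := mem_iInter₂.1 hy i hi
    simpa [indicatorBool] using this)
  exact ⟨r, fun i hi => hr _ (Finset.mem_image_of_mem f hi)⟩

/-! ### Centered families and the key lemma -/

/-- All finite powers of the partially ordered set `P` are ccc: an uncountable family in a finite
power, possibly with repetitions, has two members which are compatible in each coordinate. -/
def FinitePowersCCC (P : Type v) [PartialOrder P] : Prop :=
  ∀ (ι : Type) [Finite ι] (I : Type u) [Uncountable I] (z : I → ι → P),
    ∃ a b, a ≠ b ∧ ∀ i, Compatible (z a i) (z b i)

theorem finitePowersCCC_of_countable (P : Type v) [PartialOrder P] [Countable P] :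
    FinitePowersCCC.{u} P := by
  intro ι _ I _ z
  obtain ⟨a, b, hab, hne⟩ : ∃ a b, z a = z b ∧ a ≠ b := by
    have := not_injective_uncountable_countable z
    simpa [Function.Injective] using this
  exact ⟨a, b, hne, fun i => ⟨z a i, le_rfl, (congrFun hab i).le⟩⟩

theorem not_countable_univ (I : Type*) [Uncountable I] : ¬ (univ : Set I).Countable := by
  rw [countable_univ_iff]
  exact not_countable

theorem CCCPrecaliber.finitePowersCCC (h : CCCPrecaliber.{u}) {P : Type u} [PartialOrder P]
    (hP : IsCCCPoset P) : FinitePowersCCC.{u} P := by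
  classical
  intro ι _ I _ z
  have := Fintype.ofFinite ι
  have key : ∀ s : Finset ι, ∃ A : Set I, ¬ A.Countable ∧
      ∀ i ∈ s, CenteredOn (fun a => z a i) A := by
    intro s
    induction s using Finset.induction_on with
    | empty => exact ⟨univ, not_countable_univ I, by simp⟩
    | insert i s _ ih =>
      obtain ⟨A, hA, hcen⟩ := ih
      have : Uncountable A := not_countable_iff.1 hA
      obtain ⟨B, hB, hBc⟩ := h P hP A fun a => z a i
      refine ⟨Subtype.val '' B,
        fun hc => hB (countable_of_injective_of_countable_image Subtype.val_injective.injOn hc), ?_⟩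
      intro j hj Γ hΓ
      rcases Finset.mem_insert.1 hj with rfl | hj
      · obtain ⟨r, hr⟩ := hBc (Γ.preimage Subtype.val Subtype.val_injective.injOn) (by
          intro a ha
          obtain ⟨b, hb, hba⟩ := hΓ (Finset.mem_preimage.1 ha)
          rwa [← Subtype.ext hba])
        refine ⟨r, fun a ha => ?_⟩
        obtain ⟨b, -, rfl⟩ := hΓ ha
        exact hr b (Finset.mem_preimage.2 ha)
      · exact hcen j hj Γ fun a ha => by
          obtain ⟨b, -, rfl⟩ := hΓ ha
          exact b.2
  obtain ⟨A, hA, hcen⟩ := key Finset.univ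
  obtain ⟨a, ha, b, hb, hab⟩ : A.Nontrivial := by
    by_contra hn
    exact hA (not_nontrivial_iff.1 hn).countable
  refine ⟨a, b, hab, fun i => ?_⟩
  obtain ⟨r, hr⟩ := hcen i (Finset.mem_univ i) {a, b} (by
    intro c hc
    rcases (by simpa using hc : c = a ∨ c = b) with rfl | rfl
    exacts [ha, hb])
  exact ⟨r, hr a (by simp), hr b (by simp)⟩

/-- The members of the family `y` with index in the finite set `Γ` can be split into at most `w`
classes, each having a lower bound. -/
def Coverable {P : Type v} [PartialOrder P] {I : Type u} (w : ℕ) (y : I → P) (Γ : Finset I) :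
    Prop :=
  ∃ z : Fin w → P, ∀ a ∈ Γ, ∃ i, z i ≤ y a

theorem Coverable.union {P : Type v} [PartialOrder P] {I : Type u} [DecidableEq I] {w w' : ℕ}
    {y : I → P} {Γ Γ' : Finset I} (h : Coverable w y Γ) (h' : Coverable w' y Γ') :
    Coverable (w + w') y (Γ ∪ Γ') := by
  obtain ⟨z, hz⟩ := h
  obtain ⟨z', hz'⟩ := h'
  refine ⟨Fin.append z z', fun a ha => ?_⟩
  rcases Finset.mem_union.1 ha with ha | ha
  · obtain ⟨i, hi⟩ := hz a ha
    exact ⟨Fin.castAdd w' i, by simpa using hi⟩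
  · obtain ⟨i, hi⟩ := hz' a ha
    exact ⟨Fin.natAdd w i, by simpa using hi⟩

theorem Coverable.mono {P : Type v} [PartialOrder P] {I : Type u} {w : ℕ}
    {y : I → P} {Γ Γ' : Finset I} (h : Coverable w y Γ') (hΓ : Γ ⊆ Γ') : Coverable w y Γ := by
  obtain ⟨z, hz⟩ := h
  exact ⟨z, fun a ha => hz a (hΓ ha)⟩

theorem Coverable.mono_left {P : Type v} [PartialOrder P] [Nonempty P] {I : Type u}
    {w w' : ℕ}
    {y : I → P} {Γ : Finset I} (h : Coverable w y Γ) (hw : w ≤ w') : Coverable w' y Γ := by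
  obtain ⟨z, hz⟩ := h
  refine ⟨fun i => if hi : i.1 < w then z ⟨i, hi⟩ else Classical.arbitrary P, fun a ha => ?_⟩
  obtain ⟨i, hi⟩ := hz a ha
  exact ⟨⟨i, i.2.trans_le hw⟩, by simpa using hi⟩

theorem coverable_of_card_le {P : Type v} [PartialOrder P] [Nonempty P] {I : Type u} (y : I → P)
    {Γ : Finset I} {w : ℕ} (hw : Γ.card ≤ w) : Coverable w y Γ :=
  Coverable.mono_left (w := Γ.card)
    ⟨fun i => y (Γ.equivFin.symm i), fun a ha => ⟨Γ.equivFin ⟨a, ha⟩, by simp⟩⟩ hw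

/-- A compactness argument: if all finite subfamilies split into `w` classes with lower bounds, then
the whole family splits into `w` centered classes. -/
theorem exists_coloring_of_forall_coverable {P : Type v} [PartialOrder P] {I : Type u} {w : ℕ}
    {y : I → P} {A : Set I} (hw : 0 < w) (h : ∀ Γ : Finset I, ↑Γ ⊆ A → Coverable w y Γ) :
    ∃ col : I → Fin w, ∀ i, CenteredOn y {a ∈ A | col a = i} := by
  classical
  have : NeZero w := ⟨hw.ne'⟩
  have hex : ∀ Γ : Finset I, ∃ (z : Fin w → P) (g : I → Fin w), ∀ a ∈ Γ, a ∈ A → z (g a) ≤ y a := by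
    intro Γ
    obtain ⟨z, hz⟩ := h (Γ.filter (· ∈ A)) (by intro a ha; exact (Finset.mem_filter.1 ha).2)
    refine ⟨z, fun a => if ha : ∃ i, z i ≤ y a then ha.choose else 0, fun a ha haA => ?_⟩
    have := hz a (Finset.mem_filter.2 ⟨ha, haA⟩)
    simp only [dif_pos this]
    exact this.choose_spec
  choose z g hg using hex
  obtain ⟨χ, hχ⟩ := Finset.rado_selection g
  refine ⟨χ, fun i Γ hΓ => ?_⟩
  obtain ⟨t, hΓt, ht⟩ := hχ Γ
  refine ⟨z t i, fun a ha => ?_⟩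
  obtain ⟨haA, rfl⟩ := hΓ ha
  rw [ht a ha]
  exact hg t a (hΓt ha) haA

/-- The key lemma. Given sequences `x a` in a poset whose finite powers are ccc, suppose that for
each finite set `Γ` of indices, for almost all `n` the elements `x a n` with `a ∈ Γ` split into
`v n` classes with lower bounds. Then for uncountably many `a`, and now for *all* `n`, the elements
`x a n` split into `2 * v n` centered classes.

The point is that the poset of all finite sets which split into `2 * v n` classes for all `n` is
ccc: uncountably many members share a bound beyond which `hcov` applies to them, so that the union
of any two of them is fine at all later `n` by adding up numbers of classes, and two of them can be
chosen to be compatible at the finitely many remaining `n` by the ccc of a finite power of `P`. -/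
theorem CCCPrecaliber.exists_centered_classes (h : CCCPrecaliber.{u}) {P : Type v} [PartialOrder P]
    (hP : FinitePowersCCC.{u} P) {I : Type u} [Uncountable I] (x : I → ℕ → P) (v : ℕ → ℕ)
    (hv : ∀ n, 0 < v n)
    (hcov : ∀ Γ : Finset I, ∀ᶠ n in atTop, Coverable (v n) (fun a => x a n) Γ) :
    ∃ A : Set I, ¬ A.Countable ∧ ∀ n, ∃ col : I → Fin (v n + v n),
      ∀ i, CenteredOn (fun a => x a n) {a ∈ A | col a = i} := by
  classical
  let R := {Γ : Finset I // ∀ n, Coverable (v n + v n) (fun a => x a n) Γ}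
  have hR : IsCCCPoset Rᵒᵈ := by
    intro 𝒜 h𝒜
    by_contra hunc
    choose N hN using fun Γ : Finset I => eventually_atTop.1 (hcov Γ)
    obtain ⟨N₀, hN₀⟩ := exists_not_countable_fiber hunc
      fun Γ : Rᵒᵈ => N (OrderDual.ofDual Γ).1
    set ℬ := {Γ ∈ 𝒜 | N (OrderDual.ofDual Γ).1 = N₀} with hℬ
    have : Uncountable ℬ := not_countable_iff.1 hN₀
    choose z hz using fun (Γ : ℬ) (n : ℕ) => (OrderDual.ofDual Γ.1).2 n
    obtain ⟨Γ, Γ', hne, hcomp⟩ := hP (Σ n : Fin N₀, Fin (v n + v n)) ℬ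
      fun Γ k => z Γ k.1 k.2
    refine h𝒜 Γ.2.1 Γ'.2.1 (fun h => hne (Subtype.ext h)) ⟨OrderDual.toDual
      ⟨(OrderDual.ofDual Γ.1).1 ∪ (OrderDual.ofDual Γ'.1).1, fun n => ?_⟩,
      Finset.subset_union_left, Finset.subset_union_right⟩
    by_cases hn : n < N₀
    · choose l hl hl' using hcomp
      refine ⟨fun i => l ⟨⟨n, hn⟩, i⟩, fun a ha => ?_⟩
      rcases Finset.mem_union.1 ha with ha | ha
      · obtain ⟨i, hi⟩ := hz Γ n a ha
        exact ⟨i, (hl ⟨⟨n, hn⟩, i⟩).trans hi⟩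
      · obtain ⟨i, hi⟩ := hz Γ' n a ha
        exact ⟨i, (hl' ⟨⟨n, hn⟩, i⟩).trans hi⟩
    · rw [not_lt] at hn
      exact (hN _ n (Γ.2.2.trans_le hn)).union (hN _ n (Γ'.2.2.trans_le hn))
  have hPne : Nonempty P := Nonempty.map (fun a => x a 0) inferInstance
  have hsing : ∀ (a : I) (n : ℕ), Coverable (v n + v n) (fun a => x a n) {a} := fun a n =>
    coverable_of_card_le _ ((hv n).trans_le (Nat.le_add_left _ _))
  obtain ⟨A, hA, hcen⟩ := h Rᵒᵈ hR I fun a => OrderDual.toDual ⟨{a}, hsing a⟩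
  refine ⟨A, hA, fun n => exists_coloring_of_forall_coverable
    ((hv n).trans_le (Nat.le_add_left _ _)) fun Γ hΓ => ?_⟩
  obtain ⟨r, hr⟩ := hcen Γ hΓ
  refine ((OrderDual.ofDual r).2 n).mono fun a ha => ?_
  have : ({a} : Finset I) ⊆ (OrderDual.ofDual r).1 := hr a ha
  exact this (Finset.mem_singleton_self a)

/-! ### Domination, `σ`-centeredness and pseudo-intersections -/

/-- The nonempty finite sets of natural numbers, ordered by inclusion: a family of them is centered
if and only if its members have a common element. -/
abbrev NonemptyFinset : Type := {s : Finset ℕ // s.Nonempty}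

theorem CenteredOn.exists_mem {I : Type u} {y : I → NonemptyFinset} {A : Set I}
    (h : CenteredOn y A) : ∃ m, ∀ a ∈ A, m ∈ (y a).1 := by
  classical
  by_contra! hne
  choose b hbA hb using hne
  obtain ⟨r, hr⟩ := h (insert (b 0) ((y (b 0)).1.image b)) (by
    intro a ha
    rcases Finset.mem_insert.1 ha with rfl | ha
    · exact hbA 0
    · obtain ⟨m, -, rfl⟩ := Finset.mem_image.1 ha
      exact hbA m)
  obtain ⟨k, hk⟩ := r.2
  have hk0 : k ∈ (y (b 0)).1 := hr (b 0) (Finset.mem_insert_self _ _) hk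
  exact hb k (hr (b k) (Finset.mem_insert_of_mem (Finset.mem_image_of_mem b hk0)) hk)

/-- For each `a : ω₁`, a sequence running through the elements of `ω₁` up to `a`. -/
theorem exists_enumeration_Iic : ∃ en : OmegaOne.{u} → ℕ → OmegaOne.{u},
    ∀ a b, b ≤ a → ∃ n, en a n = b := by
  choose en hen using fun a : OmegaOne.{u} =>
    (countable_Iic_omegaOne a).exists_eq_range ⟨a, le_refl a⟩
  refine ⟨en, fun a b hb => ?_⟩
  have : b ∈ Iic a := hb
  rwa [hen a] at this

/-- At most `ℵ₁` functions on `ℕ` are eventually dominated by a single one. The `a`-th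
sequence to which the key lemma is applied dominates the first `a` functions. -/
theorem CCCPrecaliber.exists_eventually_le_atTop (h : CCCPrecaliber.{u}) {I : Type u}
    (hI : #I ≤ aleph 1) (f : I → ℕ → ℕ) : ∃ g : ℕ → ℕ, ∀ i, ∀ᶠ n in atTop, f i n ≤ g n := by
  rcases isEmpty_or_nonempty I with hIe | hIne
  · exact ⟨0, fun i => hIe.elim i⟩
  obtain ⟨σ, hσ⟩ := exists_surjective_omegaOne hI
  obtain ⟨en, hen⟩ := exists_enumeration_Iic.{u}
  have hNF : Nonempty NonemptyFinset := ⟨⟨{0}, by simp⟩⟩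
  let d : OmegaOne.{u} → ℕ → ℕ := fun a n => (Finset.range (n + 1)).sup fun k => f (σ (en a k)) n
  obtain ⟨A, hA, hcol⟩ := h.exists_centered_classes
    (finitePowersCCC_of_countable NonemptyFinset)
    (fun (a : OmegaOne.{u}) n => (⟨{d a n}, by simp⟩ : NonemptyFinset)) (fun n => n + 1)
    (fun n => n.succ_pos) fun Γ => by
      filter_upwards [eventually_ge_atTop Γ.card] with n hn
      exact coverable_of_card_le _ (hn.trans n.le_succ)
  choose col hcol using hcol
  choose m hm using fun n i => (hcol n i).exists_mem
  refine ⟨fun n => Finset.univ.sup (m n), fun i => ?_⟩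
  obtain ⟨b, rfl⟩ := hσ i
  obtain ⟨a, haA, hba⟩ := exists_gt_of_not_countable hA b
  obtain ⟨k, rfl⟩ := hen a b hba.le
  filter_upwards [eventually_ge_atTop k] with n hn
  have h1 : m n (col n a) = d a n := by simpa using hm n (col n a) a ⟨haA, rfl⟩
  calc f (σ (en a k)) n ≤ d a n :=
        Finset.le_sup (f := fun k => f (σ (en a k)) n) (Finset.mem_range.2 (Nat.lt_succ_of_le hn))
    _ = m n (col n a) := h1.symm
    _ ≤ _ := Finset.le_sup (f := m n) (Finset.mem_univ _)

theorem CCCPrecaliber.exists_eventually_le_cofinite (h : CCCPrecaliber.{u}) {I : Type u}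
    (hI : #I ≤ aleph 1) {X : Type*} [Encodable X] (f : I → X → ℕ) :
    ∃ g : X → ℕ, ∀ i, ∀ᶠ s in cofinite, f i s ≤ g s := by
  obtain ⟨g, hg⟩ := h.exists_eventually_le_atTop hI
    fun i n => (Encodable.decode n : Option X).elim 0 (f i)
  refine ⟨fun s => g (Encodable.encode s), fun i => ?_⟩
  have ht := (Encodable.encode_injective (α := X)).tendsto_cofinite
  rw [Nat.cofinite_eq_atTop] at ht
  filter_upwards [ht.eventually (hg i)] with s hs
  simpa using hs

/-- A ccc partially ordered set with at most `ℵ₁` elements is a countable union of centered sets.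
The `a`-th sequence to which the key lemma is applied enumerates the first `a` elements. -/
theorem CCCPrecaliber.exists_centered_coloring (h : CCCPrecaliber.{u}) {P : Type u}
    [PartialOrder P] [Nonempty P] (hP : IsCCCPoset P) (hcard : #P ≤ aleph 1) :
    ∃ c : P → ℕ, ∀ j, CenteredOn (id : P → P) {p | c p = j} := by
  classical
  obtain ⟨σ, hσ⟩ := exists_surjective_omegaOne hcard
  obtain ⟨en, hen⟩ := exists_enumeration_Iic.{u}
  obtain ⟨A, hA, hcol⟩ := h.exists_centered_classes (h.finitePowersCCC hP)
    (fun (a : OmegaOne.{u}) n => σ (en a n)) (fun n => n + 1)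
    (fun n => n.succ_pos) fun Γ => by
      filter_upwards [eventually_ge_atTop Γ.card] with n hn
      exact coverable_of_card_le _ (hn.trans n.le_succ)
  choose col hcol using hcol
  have hex : ∀ p, ∃ a ∈ A, ∃ n, σ (en a n) = p := by
    intro p
    obtain ⟨b, rfl⟩ := hσ p
    obtain ⟨a, haA, hba⟩ := exists_gt_of_not_countable hA b
    obtain ⟨n, rfl⟩ := hen a b hba.le
    exact ⟨a, haA, n, rfl⟩
  choose a haA n hn using hex
  refine ⟨fun p => Nat.pair (n p) (col (n p) (a p)), fun j Γ hΓ => ?_⟩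
  rcases Γ.eq_empty_or_nonempty with rfl | ⟨p₀, hp₀⟩
  · exact ⟨Classical.arbitrary P, by simp⟩
  have hj : ∀ p ∈ Γ, n p = n p₀ ∧ (col (n p) (a p) : ℕ) = col (n p₀) (a p₀) := by
    intro p hp
    have h1 : Nat.pair (n p) (col (n p) (a p)) = Nat.pair (n p₀) (col (n p₀) (a p₀)) :=
      (hΓ hp).trans (hΓ hp₀).symm
    exact Nat.pair_eq_pair.1 h1
  obtain ⟨r, hr⟩ := hcol (n p₀) (col (n p₀) (a p₀)) (Γ.image a) (by
    intro b hb
    obtain ⟨p, hp, rfl⟩ := Finset.mem_image.1 hb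
    refine ⟨haA p, Fin.ext ?_⟩
    have := hj p hp
    rw [← this.2, this.1])
  refine ⟨r, fun p hp => ?_⟩
  have h1 := hr (a p) (Finset.mem_image_of_mem a hp)
  rw [← (hj p hp).1] at h1
  exact h1.trans_eq (hn p)

/-- A family of at most `ℵ₁` sets of natural numbers with the finite intersection property admits a
sequence which is eventually in each member of the family.

The `a`-th sequence to which the key lemma is applied consists of finite pieces of
intersections of more and more of the first `a` sets. This yields two sequences such that, for any
two given sets, at almost all places one of the sequences is in both sets; passing to a subsequence
along which the first sequence stays outside of one of the sets, if there is one, a single sequence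
suffices. -/
theorem CCCPrecaliber.exists_eventually_mem (h : CCCPrecaliber.{u}) {I : Type u}
    (hI : #I ≤ aleph 1) (S : I → Set ℕ) (hS : ∀ Γ : Finset I, ∃ m, ∀ i ∈ Γ, m ∈ S i) :
    ∃ s : ℕ → ℕ, ∀ i, ∀ᶠ k in atTop, s k ∈ S i := by
  classical
  rcases isEmpty_or_nonempty I with hIe | hIne
  · exact ⟨0, fun i => hIe.elim i⟩
  obtain ⟨σ, hσ⟩ := exists_surjective_omegaOne hI
  obtain ⟨en, hen⟩ := exists_enumeration_Iic.{u}
  choose f hf using fun (Γ : Finset OmegaOne.{u}) (n : ℕ) =>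
    hS (Γ.biUnion fun a => (Finset.range n).image fun k => σ (en a k))
  replace hf : ∀ Γ n, ∀ a ∈ Γ, ∀ k < n, f Γ n ∈ S (σ (en a k)) := fun Γ n a ha k hk =>
    hf Γ n _ (Finset.mem_biUnion.2 ⟨a, ha, Finset.mem_image.2 ⟨k, Finset.mem_range.2 hk, rfl⟩⟩)
  obtain ⟨g, hg⟩ := h.exists_eventually_le_atTop
    ((mk_finset_of_infinite OmegaOne.{u}).trans mk_omegaOne).le f
  let y : OmegaOne.{u} → ℕ → Finset ℕ := fun a n =>
    (Finset.range (g n + 1)).filter fun m => ∀ k < n, m ∈ S (σ (en a k))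
  have hy : ∀ Γ, ∀ᶠ n in atTop, ∀ a ∈ Γ, f Γ n ∈ y a n := by
    intro Γ
    filter_upwards [hg Γ] with n hn a ha
    exact Finset.mem_filter.2 ⟨Finset.mem_range.2 (Nat.lt_succ_of_le hn), hf Γ n a ha⟩
  -- `y a n` is empty only for finitely many `n`, for which it may be replaced by any set
  let x : OmegaOne.{u} → ℕ → NonemptyFinset := fun a n =>
    if hne : (y a n).Nonempty then ⟨y a n, hne⟩ else ⟨{0}, by simp⟩
  have hx : ∀ {a n m}, m ∈ y a n → (x a n).1 = y a n := fun {a n m} hm => by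
    have hne : (y a n).Nonempty := ⟨m, hm⟩
    simp [x, hne]
  obtain ⟨A, hA, hcol⟩ := h.exists_centered_classes
    (finitePowersCCC_of_countable NonemptyFinset) x (fun _ => 1) (fun _ => one_pos) fun Γ => by
      filter_upwards [hy Γ] with n hn
      refine ⟨fun _ => ⟨{f Γ n}, by simp⟩, fun a ha => ⟨0, ?_⟩⟩
      intro m hm
      rw [Finset.mem_singleton.1 hm, hx (hn a ha)]
      exact hn a ha
  choose col hcol using hcol
  choose u hu using fun n i => (hcol n i).exists_mem
  have key : ∀ i j, ∀ᶠ n in atTop,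
      (u n 0 ∈ S i ∧ u n 0 ∈ S j) ∨ (u n 1 ∈ S i ∧ u n 1 ∈ S j) := by
    intro i j
    obtain ⟨b, rfl⟩ := hσ i
    obtain ⟨b', rfl⟩ := hσ j
    obtain ⟨a, haA, hba⟩ := exists_gt_of_not_countable hA (max b b')
    obtain ⟨k, rfl⟩ := hen a b ((le_max_left _ _).trans hba.le)
    obtain ⟨k', rfl⟩ := hen a b' ((le_max_right _ _).trans hba.le)
    filter_upwards [hy {a}, eventually_gt_atTop k, eventually_gt_atTop k'] with n hn hk hk'
    have h1 : u n (col n a) ∈ y a n := by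
      rw [← hx (hn a (Finset.mem_singleton_self a))]
      exact hu n (col n a) a ⟨haA, rfl⟩
    have h2 := (Finset.mem_filter.1 h1).2
    have h3 : ∀ c : Fin (1 + 1), c = 0 ∨ c = 1 := by decide
    rcases h3 (col n a) with hc | hc <;> rw [hc] at h2
    · exact Or.inl ⟨h2 k hk, h2 k' hk'⟩
    · exact Or.inr ⟨h2 k hk, h2 k' hk'⟩
  by_cases hcase : ∀ i, ∀ᶠ n in atTop, u n 0 ∈ S i
  · exact ⟨fun n => u n 0, hcase⟩
  · push Not at hcase
    obtain ⟨i₀, hi₀⟩ := hcase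
    obtain ⟨φ, hφ, hφ'⟩ := extraction_of_frequently_atTop hi₀
    refine ⟨fun k => u (φ k) 1, fun i => ?_⟩
    filter_upwards [hφ.tendsto_atTop.eventually (key i₀ i)] with k hk
    exact (hk.resolve_left fun h => hφ' k h.1).2

/-! ### The generic filter -/

/-- Let `c` colour the partially ordered set `P` so that each colour class is centered, and let `D`
be a family of at most `ℵ₁` dense sets, closed downwards. To each `r : P` a sequence `T r` can be
assigned such that every `p` of the same colour as `r` has, for almost all `k`, an extension in
`D i` of the colour of `T r k`. -/
theorem CCCPrecaliber.exists_transition (h : CCCPrecaliber.{u}) {P : Type u} [PartialOrder P]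
    (hcard : #P ≤ aleph 1) {c : P → ℕ} (hc : ∀ j, CenteredOn (id : P → P) {p | c p = j})
    {I : Type u} (hI : #I ≤ aleph 1) {D : I → Set P} (hD : ∀ i, IsDenseSubset (D i))
    (hlow : ∀ i, IsLowerSet (D i)) :
    ∃ T : P → ℕ → P, ∀ r p, c p = c r → ∀ i, ∀ᶠ k in atTop,
      ∃ q ≤ p, q ∈ D i ∧ c q = c (T r k) := by
  classical
  have hext : ∀ (Γ : Finset I) (p : P), ∃ q ≤ p, ∀ i ∈ Γ, q ∈ D i := by
    intro Γ
    induction Γ using Finset.induction_on with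
    | empty => exact fun p => ⟨p, le_rfl, by simp⟩
    | insert i Γ _ ih =>
      intro p
      obtain ⟨q, hqp, hq⟩ := ih p
      obtain ⟨r, hr, hrq⟩ := hD i q
      refine ⟨r, hrq.trans hqp, fun j hj => ?_⟩
      rcases Finset.mem_insert.1 hj with rfl | hj
      exacts [hr, hlow j hrq (hq j hj)]
  have hT : ∀ r : P, ∃ t : ℕ → P, ∀ p, c p = c r → ∀ i, ∀ᶠ k in atTop,
      ∃ q ≤ p, q ∈ D i ∧ c q = c (t k) := by
    intro r
    obtain ⟨s, hs⟩ := h.exists_eventually_mem (I := {p // c p = c r} × I)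
      (by
        rw [mk_prod, lift_id, lift_id]
        exact (mul_le_mul' (mk_subtype_le _ |>.trans hcard) hI).trans
          (mul_eq_self (aleph0_le_aleph 1)).le)
      (fun x => {j | ∃ q ≤ x.1.1, q ∈ D x.2 ∧ c q = j})
      (fun Γ => by
        obtain ⟨l, hl⟩ := hc (c r) (Γ.image fun x => x.1.1) (by
          intro p hp
          obtain ⟨x, -, rfl⟩ := Finset.mem_image.1 hp
          exact x.1.2)
        obtain ⟨q, hql, hq⟩ := hext (Γ.image Prod.snd) l
        refine ⟨c q, fun x hx => ⟨q, ?_, hq _ (Finset.mem_image_of_mem _ hx), rfl⟩⟩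
        exact hql.trans (hl _ (Finset.mem_image_of_mem (fun x => x.1.1) hx)))
    -- replace the colours by representatives; the value at unused colours is irrelevant
    refine ⟨fun k => if hk : ∃ q, c q = s k then hk.choose else r, fun p hp i => ?_⟩
    filter_upwards [hs (⟨p, hp⟩, i)] with k hk
    obtain ⟨q, hqp, hq, hqk⟩ := hk
    have hex : ∃ q, c q = s k := ⟨q, hqk⟩
    refine ⟨q, hqp, hq, ?_⟩
    simp only [dif_pos hex]
    rw [hqk, hex.choose_spec]
  choose T hT using hT
  exact ⟨T, hT⟩

/-- The generic filter. The transitions of `exists_transition` span a tree whose nodes are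
finite sequences of natural numbers; each `i` and each node determine an element `q i s` of `P`,
which decreases and lies in `D i` along every branch that grows fast enough in the sense of `i`. A
branch growing fast enough for all `i` is obtained by domination. Since elements of the same colour
are compatible, the sets `D i` deciding compatibility make the elements along this branch generate a
filter. -/
theorem CCCPrecaliber.exists_pfilter_of_isLowerSet (h : CCCPrecaliber.{u}) {P : Type u}
    [PartialOrder P] [Nonempty P] (hP : IsCCCPoset P) (hcard : #P ≤ aleph 1)
    {I : Type u} (hI : #I ≤ aleph 1) {D : I → Set P} (hD : ∀ i, IsDenseSubset (D i))
    (hlow : ∀ i, IsLowerSet (D i))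
    (hdec : ∀ p q, ∃ i, ∀ r ∈ D i, (r ≤ p ∧ r ≤ q) ∨ ¬ Compatible r p ∨ ¬ Compatible r q) :
    ∃ F : Order.PFilter P, ∀ i, ((F : Set P) ∩ D i).Nonempty := by
  classical
  obtain ⟨c, hc⟩ := h.exists_centered_coloring hP hcard
  obtain ⟨T, hT⟩ := h.exists_transition hcard hc hI hD hlow
  obtain ⟨p₀⟩ := (inferInstance : Nonempty P)
  let r : List ℕ → P := fun s => s.rec p₀ fun k _ x => T x k
  let next : I → P → P → P := fun i x t =>
    if hq : ∃ y ≤ x, y ∈ D i ∧ c y = c t then hq.choose else t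
  have hnext : ∀ {i x t}, (∃ y ≤ x, y ∈ D i ∧ c y = c t) →
      next i x t ≤ x ∧ next i x t ∈ D i := by
    intro i x t hq
    simp only [next, dif_pos hq]
    exact ⟨hq.choose_spec.1, hq.choose_spec.2.1⟩
  have hnextc : ∀ i x t, c (next i x t) = c t := by
    intro i x t
    simp only [next]
    split_ifs with hq
    exacts [hq.choose_spec.2.2, rfl]
  let q : I → List ℕ → P := fun i s => s.rec p₀ fun k s x => next i x (r (k :: s))
  have hqc : ∀ i s, c (q i s) = c (r s) := by
    intro i s
    cases s with
    | nil => rfl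
    | cons k s =>
      exact hnextc i (q i s) (r (k :: s))
  choose m hm using fun i s => eventually_atTop.1 (hT (r s) (q i s) (hqc i s) i)
  obtain ⟨g, hg⟩ := h.exists_eventually_le_cofinite hI m
  let b : ℕ → List ℕ := fun n => n.rec [] fun _ s => g s :: s
  have hblen : ∀ n, (b n).length = n := by
    intro n
    induction n with
    | zero => rfl
    | succ n ih => exact congrArg (· + 1) ih
  have hbinj : Function.Injective b := fun n n' hn => by
    rw [← hblen n, hn, hblen n']
  have hstep : ∀ i, ∀ᶠ n in atTop, q i (b (n + 1)) ≤ q i (b n) ∧ q i (b (n + 1)) ∈ D i := by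
    intro i
    have := hbinj.tendsto_cofinite
    rw [Nat.cofinite_eq_atTop] at this
    filter_upwards [this.eventually (hg i)] with n hn
    exact hnext (t := r (g (b n) :: b n)) (hm i (b n) _ hn)
  have hstep' : ∀ i, ∀ᶠ n in atTop, (∀ n' ≥ n, q i (b n') ≤ q i (b n)) ∧ q i (b n) ∈ D i := by
    intro i
    obtain ⟨N, hN⟩ := eventually_atTop.1 (hstep i)
    filter_upwards [eventually_gt_atTop N] with n hn
    constructor
    · intro n' hn'
      induction n', hn' using Nat.le_induction with
      | base => exact le_rfl
      | succ k hk ih => exact (hN k (hn.le.trans hk)).1.trans ih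
    · obtain ⟨k, rfl⟩ : ∃ k, n = k + 1 := ⟨n - 1, by lia⟩
      exact (hN k (by lia)).2
  have hcompat : ∀ i j n, Compatible (q i (b n)) (q j (b n)) := by
    intro i j n
    obtain ⟨l, hl⟩ := hc (c (r (b n))) {q i (b n), q j (b n)} (by
      intro x hx
      rcases (by simpa using hx : x = _ ∨ x = _) with rfl | rfl
      exacts [hqc i _, hqc j _])
    exact ⟨l, hl _ (Finset.mem_insert_self _ _),
      hl _ (Finset.mem_insert_of_mem (Finset.mem_singleton_self _))⟩
  let F : Set P := {p | ∃ i, ∀ᶠ n in atTop, q i (b n) ≤ p}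
  have hmemF : ∀ i, ∀ᶠ n in atTop, q i (b n) ∈ F := by
    intro i
    filter_upwards [hstep' i] with n hn
    refine ⟨i, ?_⟩
    filter_upwards [eventually_ge_atTop n] with n' hn'
    exact hn.1 n' hn'
  have hF : Order.IsPFilter F := by
    refine Order.IsPFilter.of_def ?_ ?_ ?_
    · obtain ⟨i, -⟩ := hdec p₀ p₀
      obtain ⟨n, hn⟩ := (hmemF i).exists
      exact ⟨_, hn⟩
    · rintro p ⟨i, hi⟩ p' ⟨j, hj⟩
      obtain ⟨k, hk⟩ := hdec p p'
      obtain ⟨n, hin, hjn, hkn, hkF⟩ :=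
        (hi.and (hj.and ((hstep' k).and (hmemF k)))).exists
      refine ⟨_, hkF, ?_⟩
      rcases hk _ hkn.2 with hle | hno | hno
      · exact hle
      · obtain ⟨l, h1, h2⟩ := hcompat k i n
        exact absurd ⟨l, h1, h2.trans hin⟩ hno
      · obtain ⟨l, h1, h2⟩ := hcompat k j n
        exact absurd ⟨l, h1, h2.trans hjn⟩ hno
    · rintro p p' hle ⟨i, hi⟩
      exact ⟨i, hi.mono fun n hn => hn.trans hle⟩
  refine ⟨hF.toPFilter, fun i => ?_⟩
  obtain ⟨n, hn, hnF⟩ := ((hstep' i).and (hmemF i)).exists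
  exact ⟨q i (b n), hnF, hn.2⟩

/-- The dense sets are closed downwards, and the dense sets deciding the compatibility with two given
elements are added to them. -/
theorem CCCPrecaliber.exists_pfilter_of_card_le (h : CCCPrecaliber.{u}) {P : Type u}
    [PartialOrder P] [Nonempty P] (hP : IsCCCPoset P) (hcard : #P ≤ aleph 1)
    {I : Type u} (hI : #I ≤ aleph 1) {D : I → Set P} (hD : ∀ i, IsDenseSubset (D i)) :
    ∃ F : Order.PFilter P, ∀ i, ((F : Set P) ∩ D i).Nonempty := by
  have hmul : (aleph.{u} 1) * aleph 1 = aleph 1 := mul_eq_self (aleph0_le_aleph 1)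
  have hadd : (aleph.{u} 1) + aleph 1 = aleph 1 := add_eq_self (aleph0_le_aleph 1)
  obtain ⟨F, hF⟩ := h.exists_pfilter_of_isLowerSet hP hcard (I := I ⊕ P × P)
    (D := Sum.elim (fun i => {p | ∃ d ∈ D i, p ≤ d}) fun x =>
      {r | (r ≤ x.1 ∧ r ≤ x.2) ∨ ¬ Compatible r x.1 ∨ ¬ Compatible r x.2})
    (by
      simp only [mk_sum, mk_prod, lift_id]
      exact (add_le_add hI ((mul_le_mul' hcard hcard).trans hmul.le)).trans hadd.le)
    (by
      rintro (i | ⟨p, q⟩) s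
      · obtain ⟨d, hd, hds⟩ := hD i s
        exact ⟨d, ⟨d, hd, le_rfl⟩, hds⟩
      · by_cases hp : Compatible s p
        · obtain ⟨t, hts, htp⟩ := hp
          by_cases hq : Compatible t q
          · obtain ⟨t', ht', htq⟩ := hq
            exact ⟨t', Or.inl ⟨ht'.trans htp, htq⟩, ht'.trans hts⟩
          · exact ⟨t, Or.inr (Or.inr hq), hts⟩
        · exact ⟨s, Or.inr (Or.inl hp), le_rfl⟩)
    (by
      rintro (i | ⟨p, q⟩) s t hts hs
      · obtain ⟨d, hd, hsd⟩ := hs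
        exact ⟨d, hd, hts.trans hsd⟩
      · rcases hs with hs | hs | hs
        · exact Or.inl ⟨hts.trans hs.1, hts.trans hs.2⟩
        · exact Or.inr (Or.inl fun ⟨l, h1, h2⟩ => hs ⟨l, h1.trans hts, h2⟩)
        · exact Or.inr (Or.inr fun ⟨l, h1, h2⟩ => hs ⟨l, h1.trans hts, h2⟩))
    (fun p q => ⟨Sum.inr (p, q), fun r hr => hr⟩)
  refine ⟨F, fun i => ?_⟩
  obtain ⟨p, hpF, d, hd, hpd⟩ := hF (Sum.inl i)
  exact ⟨d, F.mem_of_le hpd hpF, hd⟩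

/-- A set containing `p₀` and closed under at most `ℵ₁` unary operations and one binary operation,
of cardinality at most `ℵ₁`. -/
theorem exists_closed_subset_card_le {P I : Type u} (hI : #I ≤ aleph 1) (p₀ : P) (d : I → P → P)
    (low : P → P → P) : ∃ Q : Set P, #Q ≤ aleph 1 ∧ p₀ ∈ Q ∧ (∀ i, ∀ p ∈ Q, d i p ∈ Q) ∧
      ∀ p ∈ Q, ∀ q ∈ Q, low p q ∈ Q := by
  have hmul : (aleph.{u} 1) * aleph 1 = aleph 1 := mul_eq_self (aleph0_le_aleph 1)
  have hadd : (aleph.{u} 1) + aleph 1 = aleph 1 := add_eq_self (aleph0_le_aleph 1)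
  let Q : ℕ → Set P := fun n => n.rec ({p₀} : Set P) fun _ X =>
    X ∪ (image2 low X X ∪ image2 d univ X)
  have hsucc : ∀ n, Q (n + 1) = Q n ∪ (image2 low (Q n) (Q n) ∪ image2 d univ (Q n)) :=
    fun n => rfl
  have hmono : Monotone Q := monotone_nat_of_le_succ fun n => by
    rw [hsucc]
    exact subset_union_left
  have hcard : ∀ n : ℕ, #(↥(Q n)) ≤ aleph 1 := by
    intro n
    induction n with
    | zero =>
      change #({p₀} : Set P) ≤ _
      rw [mk_singleton]
      exact one_le_aleph0.trans (aleph0_le_aleph 1)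
    | succ n ih =>
      rw [hsucc]
      have h1 : #(image2 low (Q n) (Q n)) ≤ aleph 1 :=
        mk_image2_le.trans ((mul_le_mul' ih ih).trans hmul.le)
      have h2 : #(image2 d univ (Q n)) ≤ aleph 1 :=
        mk_image2_le.trans ((mul_le_mul' (mk_univ.trans_le hI) ih).trans hmul.le)
      refine (mk_union_le _ _).trans ((add_le_add ih ?_).trans hadd.le)
      exact (mk_union_le _ _).trans ((add_le_add h1 h2).trans hadd.le)
  refine ⟨⋃ n, Q n, ?_, mem_iUnion.2 ⟨0, rfl⟩, fun i p hp => ?_, fun p hp q hq => ?_⟩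
  · have hU := mk_iUnion_le_lift Q
    simp only [lift_uzero, mk_nat, lift_aleph0] at hU
    exact hU.trans ((mul_le_mul' (aleph0_le_aleph 1) (ciSup_le' hcard)).trans hmul.le)
  · obtain ⟨n, hn⟩ := mem_iUnion.1 hp
    refine mem_iUnion.2 ⟨n + 1, ?_⟩
    rw [hsucc]
    exact Or.inr (Or.inr (mem_image2_of_mem (mem_univ i) hn))
  · obtain ⟨n, hn⟩ := mem_iUnion.1 hp
    obtain ⟨n', hn'⟩ := mem_iUnion.1 hq
    refine mem_iUnion.2 ⟨max n n' + 1, ?_⟩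
    rw [hsucc]
    exact Or.inr (Or.inl (mem_image2_of_mem (hmono (le_max_left _ _) hn)
      (hmono (le_max_right _ _) hn')))

/-- Reduction to a partially ordered set with at most `ℵ₁` elements: a subset closed under choices of
common lower bounds and of elements of the given dense sets inherits compatibility and density. -/
theorem CCCPrecaliber.martinAxiomOmegaOne (h : CCCPrecaliber.{u}) : MartinAxiomOmegaOne.{u} := by
  classical
  intro P _ hne hP 𝒟 h𝒟 hD
  obtain ⟨p₀⟩ := hne
  have hlow : ∀ p q : P, ∃ r, Compatible p q → r ≤ p ∧ r ≤ q := by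
    intro p q
    by_cases hpq : Compatible p q
    · obtain ⟨r, hr⟩ := hpq
      exact ⟨r, fun _ => hr⟩
    · exact ⟨p, fun h => absurd h hpq⟩
  choose low hlow using hlow
  choose d hd hdle using fun (D : 𝒟) (p : P) => hD D.1 D.2 p
  obtain ⟨Q, hQcard, hp₀, hQd, hQlow⟩ := exists_closed_subset_card_le h𝒟 p₀ d low
  have hcompat : ∀ p q : Q, Compatible p.1 q.1 → Compatible p q := fun p q hpq =>
    ⟨⟨low p q, hQlow p p.2 q q.2⟩, hlow p q hpq⟩
  have hQ : IsCCCPoset Q := by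
    intro A hA
    refine countable_of_injective_of_countable_image Subtype.val_injective.injOn
      (hP (Subtype.val '' A) ?_)
    rintro _ ⟨p, hp, rfl⟩ _ ⟨q, hq, rfl⟩ hpq hc
    exact hA hp hq (fun h => hpq (congrArg _ h)) (hcompat p q hc)
  have : Nonempty Q := ⟨⟨p₀, hp₀⟩⟩
  obtain ⟨F, hF⟩ := h.exists_pfilter_of_card_le hQ hQcard h𝒟
    (D := fun D : 𝒟 => {p : Q | p.1 ∈ D.1})
    fun D p => ⟨⟨d D p, hQd D p p.2⟩, hd D p, hdle D p⟩
  have hG : Order.IsPFilter {p : P | ∃ q ∈ F, q.1 ≤ p} := by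
    refine Order.IsPFilter.of_def ?_ ?_ ?_
    · obtain ⟨q, hq⟩ := F.nonempty
      exact ⟨q, q, hq, le_rfl⟩
    · rintro p ⟨q, hq, hqp⟩ p' ⟨q', hq', hqp'⟩
      obtain ⟨l, hl, h1, h2⟩ := F.directed q hq q' hq'
      exact ⟨l, ⟨l, hl, le_rfl⟩, le_trans h1 hqp, le_trans h2 hqp'⟩
    · rintro p p' hle ⟨q, hq, hqp⟩
      exact ⟨q, hq, hqp.trans hle⟩
  refine ⟨hG.toPFilter, fun D hDm => ?_⟩
  obtain ⟨q, hqF, hqD⟩ := hF ⟨D, hDm⟩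
  exact ⟨q, ⟨q, hqF, le_rfl⟩, hqD⟩

end CompactClasses

theorem proposition3p5 :
    CompactClasses.orthogonal CompactClasses.corson.{u} = CompactClasses.caliberOmegaOne.{u} ∧
      (CompactClasses.orthogonal CompactClasses.corson.{u} = CompactClasses.ccc.{u} ↔
        CompactClasses.MartinAxiomOmegaOne.{u}) := by
  have h : CompactClasses.orthogonal CompactClasses.corson.{u} =
      CompactClasses.caliberOmegaOne.{u} :=
    Set.Subset.antisymm CompactClasses.orthogonal_corson_subset_caliberOmegaOne
      CompactClasses.caliberOmegaOne_subset_orthogonal_corson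
  refine ⟨h, fun hccc => ?_, fun hMA => ?_⟩
  · exact (CompactClasses.cccPrecaliber_of_ccc_subset
      (hccc.symm.trans h).subset).martinAxiomOmegaOne
  · exact h.trans (CompactClasses.caliberOmegaOne_subset_ccc.antisymm
      (CompactClasses.ccc_subset_caliberOmegaOne hMA))
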